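/- Let $N=Kn$ with $K,n$ positive integers, $\delta=1/K$ (so $n=\delta N$), and let $B(j)=\{i\in[N]:(j-1)n<i\le jn\}$, $j=1,\dots,K$. Let $J$ be a $\mathrm{GOE}(N)$ matrix, i.e. an $N\times N$ matrix with centered, jointly Gaussian entries with $\mathbb E J_{ij}J_{kl}=(\delta_{ik}\delta_{jl}+\delta_{il}\delta_{jk})/N$; let $\sigma^0$ be uniform on $\{\pm1\}^N$; let $U=(U^t_i)_{t\ge 0,\,i\in[N]}$ be i.i.d. uniform on $[0,1]$; assume that $J,\sigma^0,U$ are independent, and let $c:[0,1]\times\mathbb R\to\{\pm1\}$ be measurable. The block systematic scan is defined as follows: in pass $t=1,2,\dots$, starting from $\sigma^{t,0}=\sigma^{t-1}$, for $j=1,\dots,K$ in this order put $\sigma^{t,j}_i=c\big(U^t_i,(J\sigma^{t,j-1})_i\big)$ for $i\in B(j)$ and $\sigma^{t,j}_i=\sigma^{t,j-1}_i$ for $i\notin B(j)$; then $\sigma^t=\sigma^{t,K}$. Let $\sigma^{t|j}\in\mathbb R^N$ be the vector that agrees with $\sigma^t$ on $B(j)$ and vanishes off $B(j)$. For $t\ge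 0$ and $j\in\{1,\dots,K\}$ let $$\mathcal F^t_j=\sigma\Big(\{\sigma^0\}\cup\{J\sigma^{s|k}:0\le s<t,\ 1\le k\le K\}\cup\{J\sigma^{t|k}:1\le k<j\}\Big),$$ let $P^{(t)|k}$ be the orthogonal projector onto $\mathrm{span}\{\sigma^{0|k},\dots,\sigma^{t|k}\}$ (with $P^{(-1)|k}=0$), and let $$P=P^{(t)}(j)=\sum_{k<j}P^{(t)|k}+\sum_{k\ge j}P^{(t-1)|k}.$$ Let $\tilde J$ be a $\mathrm{GOE}(N)$ matrix independent of $(J,\sigma^0,U)$. Then $P$ is the orthogonal projector onto the span of all $\sigma^{s|k}$ with $(s,k)<(t,j)$ in the lexicographic order, $1\le k\le K$. Moreover, conditionally on $\mathcal F^t_j$, and more generally conditionally on any $\sigma$-field $\mathcal H$ with $\mathcal F^t_j\subseteq\mathcal H\subseteq\mathcal F^t_j\vee\sigma(U)$, $$(I-P)J(I-P)\ \stackrel{d}{=}\ (I-P)\tilde J(I-P)$$ and $$J\ \stackrel{d}{=}\ (I-P)\tilde J(I-P)+JP+PJ(I-P).$$ Here $X\stackrel{d}{=}Y$ conditionally on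 $\mathcal H$ means that $\Pr(X\in B\mid\mathcal H)=\Pr(Y\in B\mid\mathcal H)$ almost surely for every Borel set $B$ of $N\times N$ matrices. -/

import Mathlib

open MeasureTheory ProbabilityTheory

noncomputable section

/-- The product `σ`-algebra on matrices (entrywise measurability). -/
instance instMeasurableSpaceRealMatrix (m n : Type*) : MeasurableSpace (Matrix m n ℝ) :=
  inferInstanceAs (MeasurableSpace (m → n → ℝ))

/-- `J` is a `GOE(N)` matrix: its entries are centered and jointly Gaussian, with
`E[J i j * J k l] = (δ_{ik} δ_{jl} + δ_{il} δ_{jk}) / N`. -/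
structure IsGOE {Ω : Type*} {mΩ : MeasurableSpace Ω} {N : ℕ}
    (J : Ω → Matrix (Fin N) (Fin N) ℝ) (μ : Measure Ω) : Prop where
  hasGaussianLaw : HasGaussianLaw (fun ω => fun p : Fin N × Fin N => J ω p.1 p.2) μ
  mean_zero : ∀ i j, ∫ ω, J ω i j ∂μ = 0
  covariance_eq : ∀ i j k l, ∫ ω, J ω i j * J ω k l ∂μ =
    ((if i = k ∧ j = l then 1 else 0) + (if i = l ∧ j = k then 1 else 0)) / (N : ℝ)

/-- Under `μ`, the random variables `X` and `Y` have the same conditional law given the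
`σ`-algebra `m`. -/
structure CondIdentDistrib {Ω E : Type*} {mΩ : MeasurableSpace Ω} [MeasurableSpace E]
    (μ : Measure Ω) (m : MeasurableSpace Ω) (X Y : Ω → E) : Prop where
  le : m ≤ mΩ
  aemeasurable_fst : AEMeasurable X μ
  aemeasurable_snd : AEMeasurable Y μ
  condProb_eq : ∀ B : Set E, MeasurableSet B → μ⟦X ⁻¹' B | m⟧ =ᵐ[μ] μ⟦Y ⁻¹' B | m⟧

/-- A spin configuration in `{±1}^N`. -/
abbrev SpinConfig (N : ℕ) : Type := Fin N → ℤˣ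

/-- A spin configuration as a vector of `ℝ^N`. -/
def SpinConfig.toReal {N : ℕ} (s : SpinConfig N) : Fin N → ℝ := fun i => ((s i : ℤ) : ℝ)

/-- The `j`-th block of sites for blocks of size `n`, `j = 1, 2, …`. With sites numbered from `1`
it is `{i : (j - 1) n < i ≤ j n}`; the site numbered `i + 1` is `i : Fin N`. -/
def block (N n j : ℕ) : Set (Fin N) := {i | j * n < (i : ℕ) + 1 + n ∧ (i : ℕ) + 1 ≤ j * n}

open Classical in
/-- One update of block `j`: every spin of the block is replaced by `c (u i) (h i)`, where
`h = A s` are the local fields before the update; all other spins are unchanged. -/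
def blockUpdate {N : ℕ} (n : ℕ) (c : unitInterval → ℝ → ℤˣ) (A : Matrix (Fin N) (Fin N) ℝ)
    (u : Fin N → unitInterval) (j : ℕ) (s : SpinConfig N) : SpinConfig N :=
  fun i => if i ∈ block N n j then c (u i) (A.mulVec s.toReal i) else s i

/-- The configuration after blocks `1, …, j` have been updated, in this order, in one pass
started at `s` with seeds `u`. -/
def passState {N : ℕ} (n : ℕ) (c : unitInterval → ℝ → ℤˣ) (A : Matrix (Fin N) (Fin N) ℝ)
    (u : Fin N → unitInterval) (s : SpinConfig N) : ℕ → SpinConfig N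
  | 0 => s
  | j + 1 => blockUpdate n c A u (j + 1) (passState n c A u s j)

/-- The configuration `σ^t` at the end of pass `t` of the block systematic scan with `K` blocks of
size `n`, started at `s₀`; `σ^0 = s₀`, and pass `t` uses the seeds `u t`. -/
def scanState {N : ℕ} (K n : ℕ) (c : unitInterval → ℝ → ℤˣ) (A : Matrix (Fin N) (Fin N) ℝ)
    (u : ℕ → Fin N → unitInterval) (s₀ : SpinConfig N) : ℕ → SpinConfig N
  | 0 => s₀
  | t + 1 => passState n c A (u (t + 1)) (scanState K n c A u s₀ t) K

open Classical in
/-- The vector `σ^{t|j} = D^j σ^t`: the spins of block `j` after pass `t`, all other coordinates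
being set to zero. -/
def spinBlock {N : ℕ} (K n : ℕ) (c : unitInterval → ℝ → ℤˣ) (A : Matrix (Fin N) (Fin N) ℝ)
    (u : ℕ → Fin N → unitInterval) (s₀ : SpinConfig N) (t j : ℕ) : Fin N → ℝ :=
  fun i => if i ∈ block N n j then (scanState K n c A u s₀ t).toReal i else 0

/-- The matrix of the orthogonal projection of `ℝ^N` (with the Euclidean inner product) onto the
span of a set of vectors. -/
def projMatrix {N : ℕ} (S : Set (Fin N → ℝ)) : Matrix (Fin N) (Fin N) ℝ :=
  Matrix.toEuclideanLin.symm
    (Submodule.span ℝ ((WithLp.toLp 2 : (Fin N → ℝ) → EuclideanSpace ℝ (Fin N)) '' S)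
      ).starProjection.toLinearMap

/-- The projector onto the span of `σ^{s|k}`, `s < m`. So `blockProj … (t + 1) k` is `P^{(t)|k}`,
and `blockProj … 0 k = 0` is `P^{(-1)|k}`. -/
def blockProj {N : ℕ} (K n : ℕ) (c : unitInterval → ℝ → ℤˣ) (A : Matrix (Fin N) (Fin N) ℝ)
    (u : ℕ → Fin N → unitInterval) (s₀ : SpinConfig N) (m k : ℕ) : Matrix (Fin N) (Fin N) ℝ :=
  projMatrix {v | ∃ s < m, v = spinBlock K n c A u s₀ s k}

/-- `P^{(t)}(j) = ∑_{k < j} P^{(t)|k} + ∑_{k ≥ j} P^{(t-1)|k}`, where `k` ranges over the blocks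
`1, …, K`. -/
def scanProj {N : ℕ} (K n : ℕ) (c : unitInterval → ℝ → ℤˣ) (A : Matrix (Fin N) (Fin N) ℝ)
    (u : ℕ → Fin N → unitInterval) (s₀ : SpinConfig N) (t j : ℕ) : Matrix (Fin N) (Fin N) ℝ :=
  ∑ k ∈ Finset.Icc 1 K with k < j, blockProj K n c A u s₀ (t + 1) k +
    ∑ k ∈ Finset.Icc 1 K with j ≤ k, blockProj K n c A u s₀ t k

/-- The set of times `(s, k)`, `k` being one of the blocks `1, …, K`, that strictly precede
`(t, j)` in the lexicographic order. -/
def earlierTimes (K t j : ℕ) : Set (ℕ × ℕ) :=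
  {p | p.2 ∈ Finset.Icc 1 K ∧ (p.1 < t ∨ (p.1 = t ∧ p.2 < j))}

/-- The `σ`-algebra `F_j^t` generated by `σ^0` and by the products `J σ^{s|k}` for
`(s, k) < (t, j)`. -/
abbrev scanFiltration {Ω : Type*} {N : ℕ} (K n : ℕ) (c : unitInterval → ℝ → ℤˣ)
    (J : Ω → Matrix (Fin N) (Fin N) ℝ) (U : Ω → ℕ → Fin N → unitInterval)
    (σ₀ : Ω → SpinConfig N) (t j : ℕ) : MeasurableSpace Ω :=
  MeasurableSpace.comap σ₀ inferInstance ⊔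
    ⨆ p ∈ earlierTimes K t j, MeasurableSpace.comap
      (fun ω => (J ω).mulVec (spinBlock K n c (J ω) (U ω) (σ₀ ω) p.1 p.2)) inferInstance

end

/-! ### Algebra and measurability of resampling along a projector. -/

section Resample

variable {N : ℕ}

/-! For a fixed orthogonal projector `Q`, the part of a GOE matrix seen through `JQ` is independent
of the compression `(I-Q)J(I-Q)`, so replacing that compression by an independent copy preserves the
law (`HasGOECharFun.map_resample`). The projector of the scan is random, but with the seeds and the
initial configuration frozen it is predictable: the next spin block is a function of the products of
`J` with earlier blocks. `ResampleInvariant.step` therefore carries the invariance from one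
projector to the next, and lexicographic induction reaches time `(t, j)`.

Resampling changes none of the products already revealed (`scanObservation_resample`). Hence `J` and
its resampled version, each paired with the seeds and the initial configuration, have the same joint
law and the same observation. Their conditional laws then agree given any σ-algebra coarser than the
observation, in particular given any admissible `H`. -/

/-- Replace the compression of `A` to the kernel of the projector `P` by that of `A'`. -/
def resample (P A A' : Matrix (Fin N) (Fin N) ℝ) : Matrix (Fin N) (Fin N) ℝ :=
  (1 - P) * A' * (1 - P) + A * P + P * A * (1 - P)

theorem resample_zero (A A' : Matrix (Fin N) (Fin N) ℝ) : resample 0 A A' = A' := by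
  simp [resample]

/-- Resampling leaves the action on the range of `P` untouched; this is why it cannot be detected by
the revealed products. -/
theorem resample_mul_self {P : Matrix (Fin N) (Fin N) ℝ} (hP : P * P = P)
    (A A' : Matrix (Fin N) (Fin N) ℝ) : resample P A A' * P = A * P := by
  have h : (1 - P) * P = 0 := by rw [sub_mul, one_mul, hP, sub_self]
  simp only [resample, add_mul, mul_assoc, h, hP, mul_zero, zero_add, add_zero]

theorem compress_resample {P : Matrix (Fin N) (Fin N) ℝ} (hP : P * P = P)
    (A A' : Matrix (Fin N) (Fin N) ℝ) :
    (1 - P) * resample P A A' * (1 - P) = (1 - P) * A' * (1 - P) := by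
  have h : P * (1 - P) = 0 := by rw [mul_sub, mul_one, hP, sub_self]
  have h' : (1 - P) * P = 0 := by rw [sub_mul, one_mul, hP, sub_self]
  have h2 : (1 - P) * (1 - P) = 1 - P := by rw [mul_sub, mul_one, h', sub_zero]
  have e : (1 - P) * resample P A A' * (1 - P) =
      ((1 - P) * (1 - P)) * A' * ((1 - P) * (1 - P)) + (1 - P) * A * (P * (1 - P)) +
        ((1 - P) * P) * A * (1 - P) * (1 - P) := by
    simp only [resample]; noncomm_ring
  rw [e, h, h', h2]; simp

/-- For nested projectors each side keeps the `P`-part of `A`, takes from `A'` what `Q` reveals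
beyond `P`, and takes the rest from `A''`. The regrouping isolates a resampling of `(A', A'')` that
can be integrated separately. -/
theorem resample_resample {P Q : Matrix (Fin N) (Fin N) ℝ}
    (hPQ : P * Q = P) (hQP : Q * P = P) (A A' A'' : Matrix (Fin N) (Fin N) ℝ) :
    resample P A (resample Q A' A'') = resample Q (resample P A A') A'' := by
  have h1 (X : Matrix (Fin N) (Fin N) ℝ) : P * (Q * X) = P * X := by rw [← mul_assoc, hPQ]
  have h2 (X : Matrix (Fin N) (Fin N) ℝ) : Q * (P * X) = P * X := by rw [← mul_assoc, hQP]
  simp only [resample, add_mul, mul_add, sub_mul, mul_sub, one_mul, mul_one, mul_assoc, hPQ, hQP,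
    h1, h2]
  abel

theorem measurable_matrix_iff {α : Type*} [MeasurableSpace α] {m n : Type*}
    {f : α → Matrix m n ℝ} : Measurable f ↔ ∀ i j, Measurable fun x => f x i j := by
  constructor
  · intro h i j
    exact (measurable_pi_apply j).comp ((measurable_pi_apply i).comp h)
  · intro h
    exact measurable_pi_lambda _ fun i => measurable_pi_lambda _ fun j => h i j

section Measurable

variable {α : Type*} [MeasurableSpace α]

theorem Measurable.matrix_apply {m n : Type*} {f : α → Matrix m n ℝ} (hf : Measurable f)
    (i : m) (j : n) : Measurable fun x => f x i j :=
  measurable_matrix_iff.1 hf i j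

theorem Measurable.matrix_mul {f g : α → Matrix (Fin N) (Fin N) ℝ} (hf : Measurable f)
    (hg : Measurable g) : Measurable fun x => f x * g x := by
  rw [measurable_matrix_iff]
  intro i j
  simp only [Matrix.mul_apply]
  exact Finset.measurable_sum _ fun k _ => (hf.matrix_apply i k).mul (hg.matrix_apply k j)

theorem Measurable.matrix_mulVec {f : α → Matrix (Fin N) (Fin N) ℝ} {g : α → Fin N → ℝ}
    (hf : Measurable f) (hg : Measurable g) : Measurable fun x => (f x).mulVec (g x) := by
  rw [measurable_pi_iff]
  intro i
  simp only [Matrix.mulVec, dotProduct]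
  exact Finset.measurable_sum _ fun k _ =>
    (hf.matrix_apply i k).mul ((measurable_pi_apply k).comp hg)

theorem Measurable.matrix_add {f g : α → Matrix (Fin N) (Fin N) ℝ} (hf : Measurable f)
    (hg : Measurable g) : Measurable fun x => f x + g x :=
  measurable_matrix_iff.2 fun i j => (hf.matrix_apply i j).add (hg.matrix_apply i j)

theorem Measurable.one_sub_matrix {f : α → Matrix (Fin N) (Fin N) ℝ} (hf : Measurable f) :
    Measurable fun x => 1 - f x :=
  measurable_matrix_iff.2 fun i j => (hf.matrix_apply i j).const_sub _

theorem Measurable.resample {P A A' : α → Matrix (Fin N) (Fin N) ℝ} (hP : Measurable P)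
    (hA : Measurable A) (hA' : Measurable A') :
    Measurable fun x => resample (P x) (A x) (A' x) := by
  have h := hP.one_sub_matrix
  exact (((h.matrix_mul hA').matrix_mul h).matrix_add (hA.matrix_mul hP)).matrix_add
    ((hP.matrix_mul hA).matrix_mul h)

end Measurable

end Resample

/-! ### Matrices of orthogonal projectors. -/

section ProjMatrix

variable {N : ℕ}

theorem toEuclideanLin_symm_mulVec
    (L : EuclideanSpace ℝ (Fin N) →ₗ[ℝ] EuclideanSpace ℝ (Fin N)) (x : Fin N → ℝ) :
    (Matrix.toEuclideanLin.symm L).mulVec x = WithLp.ofLp (L (WithLp.toLp 2 x)) := by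
  obtain ⟨M, rfl⟩ := Matrix.toEuclideanLin.surjective L
  simp [Matrix.toLpLin_apply]

theorem projMatrix_mulVec (S : Set (Fin N → ℝ)) (x : Fin N → ℝ) :
    (projMatrix S).mulVec x = WithLp.ofLp ((Submodule.span ℝ
      ((WithLp.toLp 2 : (Fin N → ℝ) → EuclideanSpace ℝ (Fin N)) '' S)).starProjection
        (WithLp.toLp 2 x)) :=
  toEuclideanLin_symm_mulVec _ _

theorem toLp_mem_span_image {S : Set (Fin N → ℝ)} {x : Fin N → ℝ} :
    WithLp.toLp 2 x ∈ Submodule.span ℝ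
      ((WithLp.toLp 2 : (Fin N → ℝ) → EuclideanSpace ℝ (Fin N)) '' S) ↔
        x ∈ Submodule.span ℝ S := by
  have := Submodule.map_span (WithLp.linearEquiv 2 ℝ (Fin N → ℝ)).symm.toLinearMap S
  have e : ((WithLp.linearEquiv 2 ℝ (Fin N → ℝ)).symm.toLinearMap '' S) =
      ((WithLp.toLp 2 : (Fin N → ℝ) → EuclideanSpace ℝ (Fin N)) '' S) := rfl
  rw [e] at this
  rw [← this]
  constructor
  · rintro ⟨y, hy, h⟩
    have : y = x := WithLp.toLp_injective 2 h
    exact this ▸ hy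
  · intro h
    exact ⟨x, h, rfl⟩

theorem projMatrix_mulVec_mem (S : Set (Fin N → ℝ)) (x : Fin N → ℝ) :
    (projMatrix S).mulVec x ∈ Submodule.span ℝ S := by
  rw [projMatrix_mulVec, ← toLp_mem_span_image]
  exact Submodule.starProjection_apply_mem _ _

theorem projMatrix_mulVec_eq {S : Set (Fin N → ℝ)} {x y : Fin N → ℝ}
    (hy : y ∈ Submodule.span ℝ S) (h : ∀ s ∈ S, dotProduct s (x - y) = 0) :
    (projMatrix S).mulVec x = y := by
  rw [projMatrix_mulVec]
  rw [Submodule.eq_starProjection_of_mem_orthogonal (v := WithLp.toLp 2 y)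
    (toLp_mem_span_image.2 hy)]
  rw [Submodule.mem_orthogonal]
  intro u hu
  induction hu using Submodule.span_induction with
  | mem u hu =>
    obtain ⟨s, hs, rfl⟩ := hu
    have := h s hs
    rw [dotProduct_comm] at this
    simpa [EuclideanSpace.inner_eq_star_dotProduct] using this
  | zero => simp
  | add u v _ _ hu hv => rw [inner_add_left, hu, hv, add_zero]
  | smul a u _ hu => rw [inner_smul_left, hu, mul_zero]

theorem projMatrix_mulVec_of_mem {S : Set (Fin N → ℝ)} {x : Fin N → ℝ}
    (hx : x ∈ Submodule.span ℝ S) : (projMatrix S).mulVec x = x :=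
  projMatrix_mulVec_eq hx (by simp)

theorem projMatrix_mul_of_subset {S T : Set (Fin N → ℝ)} (h : S ⊆ T) :
    projMatrix T * projMatrix S = projMatrix S := by
  refine Matrix.ext_of_mulVec_single fun i => ?_
  rw [← Matrix.mulVec_mulVec]
  exact projMatrix_mulVec_of_mem (Submodule.span_mono h (projMatrix_mulVec_mem _ _))

theorem projMatrix_mul_self (S : Set (Fin N → ℝ)) :
    projMatrix S * projMatrix S = projMatrix S :=
  projMatrix_mul_of_subset subset_rfl

theorem dotProduct_projMatrix_mulVec (S : Set (Fin N → ℝ)) (x y : Fin N → ℝ) :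
    dotProduct ((projMatrix S).mulVec x) y = dotProduct x ((projMatrix S).mulVec y) := by
  have := Submodule.inner_starProjection_left_eq_right (Submodule.span ℝ
      ((WithLp.toLp 2 : (Fin N → ℝ) → EuclideanSpace ℝ (Fin N)) '' S))
      (WithLp.toLp 2 y) (WithLp.toLp 2 x)
  simp only [EuclideanSpace.inner_eq_star_dotProduct, star_trivial] at this
  rw [projMatrix_mulVec, projMatrix_mulVec]
  exact this.symm

theorem projMatrix_transpose (S : Set (Fin N → ℝ)) : (projMatrix S).transpose = projMatrix S := by
  ext i j
  have := dotProduct_projMatrix_mulVec S (Pi.single i 1) (Pi.single j 1)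
  simpa [Matrix.mulVec_single, dotProduct_comm] using this

theorem projMatrix_mul_of_subset' {S T : Set (Fin N → ℝ)} (h : S ⊆ T) :
    projMatrix S * projMatrix T = projMatrix S := by
  have := congrArg Matrix.transpose (projMatrix_mul_of_subset h)
  rwa [Matrix.transpose_mul, projMatrix_transpose, projMatrix_transpose] at this

theorem projMatrix_empty : projMatrix (∅ : Set (Fin N → ℝ)) = 0 := by
  refine Matrix.ext_of_mulVec_single fun i => ?_
  rw [projMatrix_mulVec_eq (Submodule.zero_mem _) (by simp), Matrix.zero_mulVec]

/-- The spans are mutually orthogonal, so in the sum only the projector of the family containing a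
given generator contributes to the inner product with it. -/
theorem projMatrix_biUnion {ι : Type*} (F : Finset ι) (S : ι → Set (Fin N → ℝ))
    (hS : ∀ k ∈ F, ∀ l ∈ F, k ≠ l → ∀ v ∈ S k, ∀ w ∈ S l, dotProduct v w = 0) :
    projMatrix (⋃ k ∈ F, S k) = ∑ k ∈ F, projMatrix (S k) := by
  refine Matrix.ext_of_mulVec_single fun i => ?_
  generalize (Pi.single i 1 : Fin N → ℝ) = x
  refine projMatrix_mulVec_eq ?_ ?_
  · rw [Matrix.sum_mulVec]
    refine Submodule.sum_mem _ fun k hk => ?_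
    exact Submodule.span_mono (Set.subset_biUnion_of_mem (u := S) (s := (F : Set ι)) hk)
      (projMatrix_mulVec_mem _ _)
  · intro v hv
    simp only [Set.mem_iUnion] at hv
    obtain ⟨k, hk, hv⟩ := hv
    rw [Matrix.sum_mulVec, dotProduct_sub, dotProduct_sum, Finset.sum_eq_single_of_mem k hk,
      ← dotProduct_projMatrix_mulVec, projMatrix_mulVec_of_mem (Submodule.subset_span hv), sub_self]
    intro l hl hlk
    have hz : ∀ w ∈ Submodule.span ℝ (S l), dotProduct v w = 0 := by
      intro w hw
      induction hw using Submodule.span_induction with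
      | mem w hw => exact hS k hk l hl hlk.symm v hv w hw
      | zero => simp
      | add u w _ _ hu hw => rw [dotProduct_add, hu, hw, add_zero]
      | smul a u _ hu => rw [dotProduct_smul, hu, smul_zero]
    exact hz _ (projMatrix_mulVec_mem _ _)

end ProjMatrix

/-! ### The GOE characteristic function and resampling along a fixed projector. -/

section GOELaw

variable {N : ℕ}

/-- The quadratic form `N * Var ⟨T, J⟩` for a `GOE(N)` matrix `J`. -/
def goeForm (T : Matrix (Fin N) (Fin N) ℝ) : ℝ := (T.transpose * T).trace + (T * T).trace

theorem trace_transpose_mul_eq_sum (T A : Matrix (Fin N) (Fin N) ℝ) :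
    (T.transpose * A).trace = ∑ p : Fin N × Fin N, T p.1 p.2 * A p.1 p.2 := by
  simp only [Matrix.trace, Matrix.diag_apply, Matrix.mul_apply, Matrix.transpose_apply]
  rw [Finset.sum_comm, Fintype.sum_prod_type]

/-- The two Kronecker terms select `q = p` and `q = p.swap`, which produce the two traces in
`goeForm`. -/
theorem sum_mul_covariance_goe (T : Matrix (Fin N) (Fin N) ℝ) :
    ∑ p : Fin N × Fin N, ∑ q : Fin N × Fin N, T p.1 p.2 * T q.1 q.2 *
      (((if p.1 = q.1 ∧ p.2 = q.2 then 1 else 0) + (if p.1 = q.2 ∧ p.2 = q.1 then 1 else 0)) /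
        (N : ℝ)) = goeForm T / N := by
  have h (p : Fin N × Fin N) : ∑ q : Fin N × Fin N, T p.1 p.2 * T q.1 q.2 *
      (((if p.1 = q.1 ∧ p.2 = q.2 then 1 else 0) + (if p.1 = q.2 ∧ p.2 = q.1 then 1 else 0)) /
        (N : ℝ)) = (T p.1 p.2 * T p.1 p.2 + T p.1 p.2 * T p.2 p.1) / N := by
    have e (q : Fin N × Fin N) : T p.1 p.2 * T q.1 q.2 *
      (((if p.1 = q.1 ∧ p.2 = q.2 then 1 else 0) + (if p.1 = q.2 ∧ p.2 = q.1 then 1 else 0)) /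
        (N : ℝ)) = (if q = p then T p.1 p.2 * T q.1 q.2 / N else 0) +
          (if q = p.swap then T p.1 p.2 * T q.1 q.2 / N else 0) := by
      have e1 : (p.1 = q.1 ∧ p.2 = q.2) ↔ q = p := by
        rw [Prod.ext_iff]; exact and_congr eq_comm eq_comm
      have e2 : (p.1 = q.2 ∧ p.2 = q.1) ↔ q = p.swap := by
        rw [Prod.ext_iff, and_comm]; exact and_congr eq_comm eq_comm
      simp only [e1, e2]
      split_ifs <;> ring
    simp only [e, Finset.sum_add_distrib, Finset.sum_ite_eq', Finset.mem_univ, if_true,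
      Prod.fst_swap, Prod.snd_swap]
    ring
  simp only [h]
  rw [← Finset.sum_div, Finset.sum_add_distrib, goeForm, trace_transpose_mul_eq_sum,
    Fintype.sum_prod_type (f := fun p : Fin N × Fin N => T p.1 p.2 * T p.2 p.1)]
  simp [Matrix.trace, Matrix.mul_apply]

/-- The characteristic function of a `GOE(N)` matrix. -/
theorem IsGOE.integral_exp {Ω : Type*} {mΩ : MeasurableSpace Ω} {μ : Measure Ω}
    {J : Ω → Matrix (Fin N) (Fin N) ℝ} (hJ : IsGOE J μ) (T : Matrix (Fin N) (Fin N) ℝ) :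
    ∫ ω, Complex.exp (((T.transpose * J ω).trace : ℝ) * Complex.I) ∂μ =
      Complex.exp ((-(goeForm T / N / 2) : ℝ)) := by
  have hG := hJ.hasGaussianLaw
  have := hG.isProbabilityMeasure
  let L : StrongDual ℝ (Fin N × Fin N → ℝ) :=
    ∑ p, T p.1 p.2 • ContinuousLinearMap.proj (R := ℝ) (φ := fun _ : Fin N × Fin N => ℝ) p
  have hL (A : Matrix (Fin N) (Fin N) ℝ) :
      L (fun p => A p.1 p.2) = (T.transpose * A).trace := by
    rw [trace_transpose_mul_eq_sum]
    simp [L]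
  have hm (p : Fin N × Fin N) : MemLp (fun ω => J ω p.1 p.2) 2 μ := by
    simpa using (hG.eval p).memLp_two
  have h1 := hG.charFunDual_map_eq_fun L
  rw [charFunDual_apply, integral_map hG.aemeasurable (by fun_prop)] at h1
  simp only [hL] at h1
  rw [h1]
  have hmean : ∫ ω, (T.transpose * J ω).trace ∂μ = 0 := by
    simp only [trace_transpose_mul_eq_sum]
    rw [integral_finsetSum _ fun p _ => ((hm p).integrable (by norm_num)).const_mul _]
    simp [integral_const_mul, hJ.mean_zero]
  have hmem : MemLp (fun ω => (T.transpose * J ω).trace) 2 μ := by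
    simp only [trace_transpose_mul_eq_sum]
    exact memLp_finsetSum _ fun p _ => (hm p).const_mul _
  have hvar : Var[fun ω => (T.transpose * J ω).trace; μ] = goeForm T / N := by
    rw [variance_eq_sub hmem, hmean]
    have e (ω : Ω) : ((fun ω => (T.transpose * J ω).trace) ^ 2) ω =
        ∑ p : Fin N × Fin N, ∑ q : Fin N × Fin N, T p.1 p.2 * T q.1 q.2 *
          (J ω p.1 p.2 * J ω q.1 q.2) := by
      simp only [Pi.pow_apply, trace_transpose_mul_eq_sum]
      rw [sq, Finset.sum_mul_sum]
      exact Finset.sum_congr rfl fun p _ => Finset.sum_congr rfl fun q _ => by ring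
    have hi (p q : Fin N × Fin N) :
        Integrable (fun ω => T p.1 p.2 * T q.1 q.2 * (J ω p.1 p.2 * J ω q.1 q.2)) μ :=
      ((hm p).integrable_mul (hm q)).const_mul _
    simp only [e]
    rw [integral_finsetSum _ fun p _ => integrable_finsetSum _ fun q _ => hi p q]
    rw [Finset.sum_congr rfl fun p _ => integral_finsetSum _ fun q _ => hi p q]
    simp only [integral_const_mul, hJ.covariance_eq]
    rw [sum_mul_covariance_goe]
    ring
  rw [hmean, hvar]
  congr 1
  push_cast
  ring

theorem measure_matrix_ext_of_integral_exp {γ γ' : Measure (Matrix (Fin N) (Fin N) ℝ)}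
    [IsFiniteMeasure γ] [IsFiniteMeasure γ']
    (h : ∀ T : Matrix (Fin N) (Fin N) ℝ,
      ∫ A, Complex.exp (((T.transpose * A).trace : ℝ) * Complex.I) ∂γ =
        ∫ A, Complex.exp (((T.transpose * A).trace : ℝ) * Complex.I) ∂γ') : γ = γ' := by
  -- The laws are transported to functions on index pairs, where every continuous functional is the
  -- trace pairing with the matrix of its values on basis vectors.
  let e : Matrix (Fin N) (Fin N) ℝ → (Fin N × Fin N → ℝ) := fun A p => A p.1 p.2
  let e' : (Fin N × Fin N → ℝ) → Matrix (Fin N) (Fin N) ℝ := fun f i j => f (i, j)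
  have he : Measurable e := measurable_pi_lambda _ fun p => measurable_id.matrix_apply _ _
  have he' : Measurable e' := measurable_matrix_iff.2 fun i j => measurable_pi_apply _
  have hc (δ : Measure (Matrix (Fin N) (Fin N) ℝ)) : (δ.map e).map e' = δ := by
    rw [Measure.map_map he' he]
    exact Measure.map_id
  rw [← hc γ, ← hc γ']
  congr 1
  refine Measure.ext_of_charFunDual ?_
  funext L
  let T : Matrix (Fin N) (Fin N) ℝ := fun i j => L (Pi.single (i, j) 1)
  have hL (A : Matrix (Fin N) (Fin N) ℝ) : L (e A) = (T.transpose * A).trace := by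
    rw [trace_transpose_mul_eq_sum]
    conv_lhs => rw [← Finset.univ_sum_single (e A), map_sum]
    refine Finset.sum_congr rfl fun p _ => ?_
    have : (Pi.single p (e A p) : Fin N × Fin N → ℝ) = e A p • Pi.single p 1 := by
      rw [← Pi.single_smul]; simp
    rw [this, map_smul, smul_eq_mul, mul_comm]
  simp only [charFunDual_apply]
  rw [integral_map he.aemeasurable (by fun_prop), integral_map he.aemeasurable (by fun_prop)]
  simpa only [hL] using h T

/-- The cross terms vanish: every term of the first part has a factor `Q` at one end, and `Q` kills
the second part from both sides. This is the Gaussian independence of the revealed part and the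
compression, in terms of variances. -/
theorem goeForm_eq_add {Q : Matrix (Fin N) (Fin N) ℝ} (hQ : Q * Q = Q)
    (hQt : Q.transpose = Q) (T : Matrix (Fin N) (Fin N) ℝ) :
    goeForm T = goeForm (T * Q + Q * T * (1 - Q)) + goeForm ((1 - Q) * T * (1 - Q)) := by
  have z1 : (1 - Q) * Q = 0 := by rw [sub_mul, one_mul, hQ, sub_self]
  have z2 : Q * (1 - Q) = 0 := by rw [mul_sub, mul_one, hQ, sub_self]
  set T1 := T * Q + Q * T * (1 - Q) with hT1
  set T2 := (1 - Q) * T * (1 - Q) with hT2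
  have hT : T = T1 + T2 := by rw [hT1, hT2]; noncomm_ring
  have hr : T2 * Q = 0 := by rw [hT2, mul_assoc, z1, mul_zero]
  have hl : Q * T2 = 0 := by rw [hT2, ← mul_assoc, ← mul_assoc, z2, zero_mul, zero_mul]
  have h1 : (T1.transpose * T2).trace = 0 := by
    have : T1.transpose * T2 = Q * (T.transpose * T2) +
        (1 - Q) * T.transpose * (Q * T2) := by
      rw [hT1]
      simp only [Matrix.transpose_add, Matrix.transpose_mul, Matrix.transpose_sub,
        Matrix.transpose_one, hQt]
      noncomm_ring
    rw [this, hl, mul_zero, add_zero, Matrix.trace_mul_comm, mul_assoc, hr, mul_zero,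
      Matrix.trace_zero]
  have h2 : (T1 * T2).trace = 0 := by
    have : T1 * T2 = T * (Q * T2) + Q * (T * (1 - Q) * T2) := by
      rw [hT1]; noncomm_ring
    rw [this, hl, mul_zero, zero_add, Matrix.trace_mul_comm, mul_assoc, hr, mul_zero,
      Matrix.trace_zero]
  have h3 : (T2.transpose * T1).trace = 0 := by
    rw [← Matrix.trace_transpose, Matrix.transpose_mul, Matrix.transpose_transpose, h1]
  have h4 : (T2 * T1).trace = 0 := by rw [Matrix.trace_mul_comm, h2]
  rw [hT]
  simp only [goeForm, Matrix.transpose_add, add_mul, mul_add, Matrix.trace_add, h1, h2, h3, h4]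
  ring

/-- Cyclicity of the trace moves the projectors onto the test matrix, so that `A` and `A'` are
tested against the two parts in `goeForm_eq_add`. -/
theorem trace_transpose_mul_resample {Q : Matrix (Fin N) (Fin N) ℝ}
    (hQt : Q.transpose = Q) (T A A' : Matrix (Fin N) (Fin N) ℝ) :
    (T.transpose * resample Q A A').trace =
      ((T * Q + Q * T * (1 - Q)).transpose * A).trace +
        (((1 - Q) * T * (1 - Q)).transpose * A').trace := by
  have h1 : (T.transpose * ((1 - Q) * A' * (1 - Q))).trace =
      ((1 - Q) * (T.transpose * (1 - Q)) * A').trace := by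
    rw [← mul_assoc, Matrix.trace_mul_comm]; simp only [mul_assoc]
  have h2 : (T.transpose * (A * Q)).trace = (Q * T.transpose * A).trace := by
    rw [← mul_assoc, Matrix.trace_mul_comm, mul_assoc]
  have h3 : (T.transpose * (Q * A * (1 - Q))).trace =
      ((1 - Q) * (T.transpose * Q) * A).trace := by
    rw [← mul_assoc, Matrix.trace_mul_comm]; simp only [mul_assoc]
  simp only [resample, Matrix.transpose_add, Matrix.transpose_mul, Matrix.transpose_sub,
    Matrix.transpose_one, hQt, mul_add (T.transpose), add_mul _ _ A, Matrix.trace_add, h1, h2, h3]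
  ring

/-- The law of a `GOE(N)` matrix, described by its characteristic function. -/
def HasGOECharFun (γ : Measure (Matrix (Fin N) (Fin N) ℝ)) : Prop :=
  ∀ T : Matrix (Fin N) (Fin N) ℝ,
    ∫ A, Complex.exp (((T.transpose * A).trace : ℝ) * Complex.I) ∂γ =
      Complex.exp ((-(goeForm T / N / 2) : ℝ))

theorem measurable_exp_trace (T : Matrix (Fin N) (Fin N) ℝ) :
    Measurable fun A : Matrix (Fin N) (Fin N) ℝ =>
      Complex.exp (((T.transpose * A).trace : ℝ) * Complex.I) := by
  simp only [trace_transpose_mul_eq_sum]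
  have : Measurable fun A : Matrix (Fin N) (Fin N) ℝ =>
      ∑ p : Fin N × Fin N, T p.1 p.2 * A p.1 p.2 :=
    Finset.measurable_sum _ fun p _ => (measurable_id.matrix_apply p.1 p.2).const_mul _
  fun_prop

theorem IsGOE.hasGOECharFun {Ω : Type*} {mΩ : MeasurableSpace Ω} {μ : Measure Ω}
    {J : Ω → Matrix (Fin N) (Fin N) ℝ} (hJ : IsGOE J μ) (hm : Measurable J) :
    HasGOECharFun (μ.map J) := by
  intro T
  rw [integral_map hm.aemeasurable (measurable_exp_trace T).aestronglyMeasurable]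
  exact hJ.integral_exp T

theorem HasGOECharFun.eq {γ γ' : Measure (Matrix (Fin N) (Fin N) ℝ)}
    [IsFiniteMeasure γ] [IsFiniteMeasure γ'] (h : HasGOECharFun γ) (h' : HasGOECharFun γ') :
    γ = γ' :=
  measure_matrix_ext_of_integral_exp fun T => (h T).trans (h' T).symm

/-- Resampling along a fixed projector preserves the `GOE(N)` law. -/
theorem HasGOECharFun.map_resample {γ : Measure (Matrix (Fin N) (Fin N) ℝ)}
    [IsProbabilityMeasure γ] (h : HasGOECharFun γ) {Q : Matrix (Fin N) (Fin N) ℝ}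
    (hQ : Q * Q = Q) (hQt : Q.transpose = Q) :
    (γ.prod γ).map (fun p => resample Q p.1 p.2) = γ := by
  have hm : Measurable fun p : Matrix (Fin N) (Fin N) ℝ × Matrix (Fin N) (Fin N) ℝ =>
    resample Q p.1 p.2 := measurable_const.resample measurable_fst measurable_snd
  have := Measure.isProbabilityMeasure_map (μ := γ.prod γ) hm.aemeasurable
  refine HasGOECharFun.eq (fun T => ?_) h
  rw [integral_map hm.aemeasurable (measurable_exp_trace T).aestronglyMeasurable]
  simp only [trace_transpose_mul_resample hQt, Complex.ofReal_add, add_mul (Complex.ofReal _),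
    Complex.exp_add]
  rw [integral_prod_mul (fun A : Matrix (Fin N) (Fin N) ℝ =>
      Complex.exp ((((T * Q + Q * T * (1 - Q)).transpose * A).trace : ℝ) * Complex.I))
    (fun A : Matrix (Fin N) (Fin N) ℝ =>
      Complex.exp (((((1 - Q) * T * (1 - Q)).transpose * A).trace : ℝ) * Complex.I)),
    h, h, ← Complex.exp_add, goeForm_eq_add hQ hQt T]
  congr 1
  push_cast
  ring

end GOELaw

/-! ### Resampling along projectors that depend on the matrix. -/

section Adaptive

variable {N : ℕ}

/-- Resampling along the matrix-dependent projector `P` preserves the law `γ`. -/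
def ResampleInvariant (γ : Measure (Matrix (Fin N) (Fin N) ℝ))
    (P : Matrix (Fin N) (Fin N) ℝ → Matrix (Fin N) (Fin N) ℝ) : Prop :=
  ∀ f : Matrix (Fin N) (Fin N) ℝ → ENNReal, Measurable f →
    ∫⁻ A, ∫⁻ A', f (resample (P A) A A') ∂γ ∂γ = ∫⁻ A, f A ∂γ

theorem resampleInvariant_zero (γ : Measure (Matrix (Fin N) (Fin N) ℝ))
    [IsProbabilityMeasure γ] : ResampleInvariant γ fun _ => 0 := by
  intro f _
  simp [resample_zero]

theorem HasGOECharFun.lintegral_resample {γ : Measure (Matrix (Fin N) (Fin N) ℝ)}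
    [IsProbabilityMeasure γ] (h : HasGOECharFun γ) {Q : Matrix (Fin N) (Fin N) ℝ}
    (hQ : Q * Q = Q) (hQt : Q.transpose = Q) : ResampleInvariant γ fun _ => Q := by
  intro f hf
  have hm : Measurable fun p : Matrix (Fin N) (Fin N) ℝ × Matrix (Fin N) (Fin N) ℝ =>
    resample Q p.1 p.2 := measurable_const.resample measurable_fst measurable_snd
  conv_rhs => rw [← h.map_resample hQ hQt, lintegral_map hf hm]
  exact (lintegral_prod _ (hf.comp hm).aemeasurable).symm

/-- If resampling along `P` preserves the `GOE(N)` law and the larger projector `Q` depends only on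
the part of the matrix that `P` reveals, then resampling along `Q` preserves the law as well. -/
theorem ResampleInvariant.step {γ : Measure (Matrix (Fin N) (Fin N) ℝ)}
    [IsProbabilityMeasure γ] (hγ : HasGOECharFun γ)
    {P Q : Matrix (Fin N) (Fin N) ℝ → Matrix (Fin N) (Fin N) ℝ}
    (hQm : Measurable Q)
    (hP : ∀ A, P A * P A = P A) (hQ : ∀ A, Q A * Q A = Q A)
    (hQt : ∀ A, (Q A).transpose = Q A)
    (hPQ : ∀ A, P A * Q A = P A) (hQP : ∀ A, Q A * P A = P A)
    (hadapt : ∀ A X, X * P A = A * P A → Q X = Q A)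
    (h : ResampleInvariant γ P) : ResampleInvariant γ Q := by
  intro f hf
  have hg : Measurable fun X => ∫⁻ A'', f (resample (Q X) X A'') ∂γ := by
    refine Measurable.lintegral_prod_right' (f := fun p : Matrix (Fin N) (Fin N) ℝ ×
      Matrix (Fin N) (Fin N) ℝ => f (resample (Q p.1) p.1 p.2)) ?_
    exact hf.comp ((hQm.comp measurable_fst).resample measurable_fst measurable_snd)
  -- Invariance along `P` is used on both sides; afterwards the outer matrix `A`, and with it `P A`
  -- and `Q A`, can be frozen.
  rw [← h _ hg, ← h f hf]
  refine lintegral_congr fun A => ?_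
  have e (A' : Matrix (Fin N) (Fin N) ℝ) :
      ∫⁻ A'', f (resample (Q (resample (P A) A A')) (resample (P A) A A') A'') ∂γ =
        ∫⁻ A'', f (resample (P A) A (resample (Q A) A' A'')) ∂γ := by
    rw [hadapt A _ (resample_mul_self (hP A) A A')]
    simp only [resample_resample (hPQ A) (hQP A)]
  simp only [e]
  -- Since `Q A` does not depend on `A'` or `A''`, the fixed-projector case merges these two copies
  -- into one.
  exact hγ.lintegral_resample (hQ A) (hQt A) (fun Y => f (resample (P A) A Y))
    (hf.comp (measurable_const.resample measurable_const measurable_id))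

end Adaptive

/-! ### Combinatorics of blocks and of the lexicographic order. -/

section Blocks

variable {N : ℕ}

theorem block_unique {n k l : ℕ} {i : Fin N} (hk : i ∈ block N n k) (hl : i ∈ block N n l) :
    k = l := by
  simp only [block, Set.mem_ofPred_eq] at hk hl
  by_contra hne
  rcases Nat.lt_or_gt_of_ne hne with h | h
  · have := Nat.mul_le_mul_right n (Nat.succ_le_of_lt h)
    rw [Nat.succ_mul] at this
    omega
  · have := Nat.mul_le_mul_right n (Nat.succ_le_of_lt h)
    rw [Nat.succ_mul] at this
    omega

theorem exists_mem_block {K n : ℕ} (hN : N = K * n) (i : Fin N) :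
    ∃ k ∈ Finset.Icc 1 K, i ∈ block N n k := by
  have hi : (i : ℕ) < K * n := hN ▸ i.2
  have hn : 0 < n := Nat.pos_of_ne_zero fun h => by simp [h] at hi
  have hlt : (i : ℕ) / n < K := (Nat.div_lt_iff_lt_mul hn).2 hi
  have h1 := Nat.div_mul_le_self (i : ℕ) n
  have h2 := Nat.lt_div_mul_add (a := (i : ℕ)) hn
  generalize (i : ℕ) / n = q at hlt h1 h2
  -- Sites of `Fin N` are counted from zero but blocks from one, hence the shift of the quotient.
  refine ⟨q + 1, Finset.mem_Icc.2 ⟨by omega, by omega⟩, ?_⟩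
  simp only [block, Set.mem_ofPred_eq, Nat.succ_mul]
  omega

theorem mem_earlierTimes {K t j : ℕ} {p : ℕ × ℕ} :
    p ∈ earlierTimes K t j ↔ p.2 ∈ Finset.Icc 1 K ∧ (p.1 < t ∨ (p.1 = t ∧ p.2 < j)) :=
  Iff.rfl

theorem earlierTimes_subset {K t j : ℕ} {p : ℕ × ℕ} (hp : p ∈ earlierTimes K t j) :
    earlierTimes K p.1 p.2 ⊆ earlierTimes K t j := by
  intro q hq
  rw [mem_earlierTimes] at *
  exact ⟨hq.1, by omega⟩

theorem earlierTimes_zero_one (K : ℕ) : earlierTimes K 0 1 = ∅ := by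
  ext p
  simp only [mem_earlierTimes, Finset.mem_Icc, Set.mem_empty_iff_false, iff_false]
  omega

/-- The fictitious block `K + 1` marks the end of a pass and lets the induction roll over to the
next one. -/
theorem earlierTimes_succ_one (K t : ℕ) : earlierTimes K (t + 1) 1 = earlierTimes K t (K + 1) := by
  ext p
  simp only [mem_earlierTimes, Finset.mem_Icc]
  omega

theorem mem_earlierTimes_succ {K t j : ℕ} {p : ℕ × ℕ} (hp : p ∈ earlierTimes K t (j + 1)) :
    p ∈ earlierTimes K t j ∨ p = (t, j) := by
  rw [mem_earlierTimes, Prod.ext_iff] at *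
  simp only
  have := hp.1
  rcases hp.2 with h | h
  · exact Or.inl ⟨this, Or.inl h⟩
  · by_cases e : p.2 = j
    · exact Or.inr ⟨h.1, e⟩
    · exact Or.inl ⟨this, Or.inr ⟨h.1, by omega⟩⟩

theorem earlierTimes_subset_succ (K t j : ℕ) : earlierTimes K t j ⊆ earlierTimes K t (j + 1) := by
  intro p hp
  rw [mem_earlierTimes] at *
  exact ⟨hp.1, by omega⟩

end Blocks

/-! ### Predictability of the spin blocks and of the projector. -/

section Scan

variable {N K n : ℕ} {c : unitInterval → ℝ → ℤˣ}

/-- By disjointness of blocks, a site of block `k` changes only at the `k`-th update of a pass. -/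
theorem passState_apply {A : Matrix (Fin N) (Fin N) ℝ} {u : Fin N → unitInterval}
    {s : SpinConfig N} {k : ℕ} (hk : 1 ≤ k) {i : Fin N} (hi : i ∈ block N n k) (m : ℕ) :
    passState n c A u s m i =
      if k ≤ m then c (u i) (A.mulVec (passState n c A u s (k - 1)).toReal i) else s i := by
  induction m with
  | zero => rw [if_neg (by omega)]; rfl
  | succ m ih =>
    rw [passState, blockUpdate]
    by_cases h : i ∈ block N n (m + 1)
    · have := block_unique hi h
      subst this
      rw [if_pos h, if_pos le_rfl, Nat.add_sub_cancel]
    · have hne : k ≠ m + 1 := fun e => h (e ▸ hi)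
      rw [if_neg h, ih]
      exact if_congr (by omega) rfl rfl

variable (K n c) in
theorem scanState_succ_apply {A : Matrix (Fin N) (Fin N) ℝ} {u : ℕ → Fin N → unitInterval}
    {s₀ : SpinConfig N} {k t : ℕ} (hk : k ∈ Finset.Icc 1 K) {i : Fin N} (hi : i ∈ block N n k) :
    scanState K n c A u s₀ (t + 1) i = c (u (t + 1) i)
      (A.mulVec (passState n c A (u (t + 1)) (scanState K n c A u s₀ t) (k - 1)).toReal i) := by
  rw [Finset.mem_Icc] at hk
  rw [scanState, passState_apply hk.1 hi, if_pos hk.2]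

theorem spinBlock_of_mem {A : Matrix (Fin N) (Fin N) ℝ} {u : ℕ → Fin N → unitInterval}
    {s₀ : SpinConfig N} {t k : ℕ} {i : Fin N} (hi : i ∈ block N n k) :
    spinBlock K n c A u s₀ t k i = (scanState K n c A u s₀ t).toReal i := if_pos hi

theorem spinBlock_of_notMem {A : Matrix (Fin N) (Fin N) ℝ} {u : ℕ → Fin N → unitInterval}
    {s₀ : SpinConfig N} {t k : ℕ} {i : Fin N} (hi : i ∉ block N n k) :
    spinBlock K n c A u s₀ t k i = 0 := if_neg hi

theorem spinBlock_dotProduct_eq_zero {A : Matrix (Fin N) (Fin N) ℝ}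
    {u : ℕ → Fin N → unitInterval} {s₀ : SpinConfig N} {s t k l : ℕ} (hkl : k ≠ l) :
    dotProduct (spinBlock K n c A u s₀ s k) (spinBlock K n c A u s₀ t l) = 0 := by
  refine Finset.sum_eq_zero fun i _ => ?_
  by_cases hi : i ∈ block N n k
  · rw [spinBlock_of_notMem fun h => hkl (block_unique hi h), mul_zero]
  · rw [spinBlock_of_notMem hi, zero_mul]

/-- The configuration before the update of block `k` is the sum of its most recent blocks. -/
theorem passState_toReal_eq_sum (hN : N = K * n) {A : Matrix (Fin N) (Fin N) ℝ}
    {u : ℕ → Fin N → unitInterval} {s₀ : SpinConfig N} {t k : ℕ} (hk : k ∈ Finset.Icc 1 K) :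
    (passState n c A (u (t + 1)) (scanState K n c A u s₀ t) (k - 1)).toReal =
      ∑ l ∈ Finset.Icc 1 K, spinBlock K n c A u s₀ (if l < k then t + 1 else t) l := by
  funext i
  obtain ⟨l, hl, hi⟩ := exists_mem_block hN i
  have hl' := Finset.mem_Icc.1 hl
  have hk' := Finset.mem_Icc.1 hk
  rw [Finset.sum_apply, Finset.sum_eq_single_of_mem l hl fun m _ hm =>
    spinBlock_of_notMem fun h => hm (block_unique h hi), spinBlock_of_mem hi]
  simp only [SpinConfig.toReal]
  rw [passState_apply hl'.1 hi]
  by_cases h : l < k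
  · rw [if_pos (by omega), if_pos h, scanState_succ_apply K n c hl hi]
  · rw [if_neg (by omega), if_neg h]

/-- The block `(t, k)` depends on the matrix only through its products with earlier blocks. -/
theorem spinBlock_congr (hN : N = K * n) {A X : Matrix (Fin N) (Fin N) ℝ}
    {u : ℕ → Fin N → unitInterval} {s₀ : SpinConfig N} (t k : ℕ) (hk : k ∈ Finset.Icc 1 K)
    (h : ∀ p ∈ earlierTimes K t k, X.mulVec (spinBlock K n c A u s₀ p.1 p.2) =
      A.mulVec (spinBlock K n c A u s₀ p.1 p.2)) :
    spinBlock K n c X u s₀ t k = spinBlock K n c A u s₀ t k := by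
  -- Lexicographic recursion: the earlier blocks coincide for `X` and `A`, so the local fields, sums
  -- of products with such blocks, coincide as well.
  have ih : ∀ p ∈ earlierTimes K t k,
      spinBlock K n c X u s₀ p.1 p.2 = spinBlock K n c A u s₀ p.1 p.2 := fun p hp =>
    spinBlock_congr hN p.1 p.2 hp.1 fun q hq => h q (earlierTimes_subset hp hq)
  funext i
  by_cases hi : i ∈ block N n k
  swap
  · rw [spinBlock_of_notMem hi, spinBlock_of_notMem hi]
  rw [spinBlock_of_mem hi, spinBlock_of_mem hi]
  cases t with
  | zero => rfl
  | succ t =>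
    simp only [SpinConfig.toReal]
    rw [scanState_succ_apply K n c hk hi, scanState_succ_apply K n c hk hi,
      passState_toReal_eq_sum hN hk, passState_toReal_eq_sum hN hk, Matrix.mulVec_sum,
      Matrix.mulVec_sum]
    have e : ∀ l ∈ Finset.Icc 1 K,
        X.mulVec (spinBlock K n c X u s₀ (if l < k then t + 1 else t) l) =
          A.mulVec (spinBlock K n c A u s₀ (if l < k then t + 1 else t) l) := by
      intro l hl
      have hp : ((if l < k then t + 1 else t), l) ∈ earlierTimes K (t + 1) k := by
        refine ⟨hl, ?_⟩
        by_cases hlk : l < k <;> simp [hlk]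
      have h1 := ih _ hp
      have h2 := h _ hp
      simp only at h1 h2
      rw [h1, h2]
    rw [Finset.sum_congr rfl e]
termination_by (t, k)
decreasing_by
  rcases hp.2 with h' | ⟨h', h''⟩
  · exact Prod.Lex.left _ _ h'
  · rw [h']; exact Prod.Lex.right _ h''

/-- The spin blocks revealed before time `(t, j)`. -/
def revealedBlocks (K n : ℕ) (c : unitInterval → ℝ → ℤˣ) (A : Matrix (Fin N) (Fin N) ℝ)
    (u : ℕ → Fin N → unitInterval) (s₀ : SpinConfig N) (t j : ℕ) : Set (Fin N → ℝ) :=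
  (fun p => spinBlock K n c A u s₀ p.1 p.2) '' earlierTimes K t j

theorem mulVec_eq_of_mul_projMatrix_eq {S : Set (Fin N → ℝ)} {A X : Matrix (Fin N) (Fin N) ℝ}
    (h : X * projMatrix S = A * projMatrix S) {v : Fin N → ℝ} (hv : v ∈ S) :
    X.mulVec v = A.mulVec v := by
  have := congrArg (fun M => M.mulVec v) h
  simpa only [← Matrix.mulVec_mulVec, projMatrix_mulVec_of_mem (Submodule.subset_span hv)]
    using this

theorem spinBlock_eq_of_mul_projMatrix_eq (hN : N = K * n) {A X : Matrix (Fin N) (Fin N) ℝ}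
    {u : ℕ → Fin N → unitInterval} {s₀ : SpinConfig N} {t j : ℕ}
    (h : X * projMatrix (revealedBlocks K n c A u s₀ t j) =
      A * projMatrix (revealedBlocks K n c A u s₀ t j)) {p : ℕ × ℕ}
    (hp : p ∈ earlierTimes K t j ∨ p = (t, j)) (hpK : p.2 ∈ Finset.Icc 1 K) :
    spinBlock K n c X u s₀ p.1 p.2 = spinBlock K n c A u s₀ p.1 p.2 := by
  refine spinBlock_congr hN p.1 p.2 hpK fun q hq => ?_
  refine mulVec_eq_of_mul_projMatrix_eq h (Set.mem_image_of_mem _ ?_)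
  rcases hp with hp | rfl
  · exact earlierTimes_subset hp hq
  · exact hq

/-- The second conclusion reaches one time further than the hypothesis: block `(t, j)` is computed
from products with strictly earlier blocks. This is the adaptedness needed in
`ResampleInvariant.step`. -/
theorem revealedBlocks_eq_of_mul_projMatrix_eq (hN : N = K * n)
    {A X : Matrix (Fin N) (Fin N) ℝ}
    {u : ℕ → Fin N → unitInterval} {s₀ : SpinConfig N} {t j : ℕ}
    (h : X * projMatrix (revealedBlocks K n c A u s₀ t j) =
      A * projMatrix (revealedBlocks K n c A u s₀ t j)) :
    revealedBlocks K n c X u s₀ t j = revealedBlocks K n c A u s₀ t j ∧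
      revealedBlocks K n c X u s₀ t (j + 1) = revealedBlocks K n c A u s₀ t (j + 1) :=
  ⟨Set.image_congr fun _ hp => spinBlock_eq_of_mul_projMatrix_eq hN h (Or.inl hp) hp.1,
    Set.image_congr fun _ hp =>
      spinBlock_eq_of_mul_projMatrix_eq hN h (mem_earlierTimes_succ hp) hp.1⟩

/-- Different blocks have disjoint supports, so their spans are orthogonal and the projectors add
up. -/
theorem scanProj_eq_projMatrix (A : Matrix (Fin N) (Fin N) ℝ)
    (u : ℕ → Fin N → unitInterval) (s₀ : SpinConfig N) (t j : ℕ) :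
    scanProj K n c A u s₀ t j = projMatrix (revealedBlocks K n c A u s₀ t j) := by
  have hU : revealedBlocks K n c A u s₀ t j = ⋃ k ∈ Finset.Icc 1 K,
      {v | ∃ s < (if k < j then t + 1 else t), v = spinBlock K n c A u s₀ s k} := by
    ext v
    simp only [revealedBlocks, Set.mem_image, Set.mem_iUnion, Set.mem_ofPred_eq, exists_prop]
    constructor
    · rintro ⟨p, ⟨hp, hlt⟩, rfl⟩
      refine ⟨p.2, hp, p.1, ?_, rfl⟩
      split_ifs <;> omega
    · rintro ⟨k, hk, s, hs, rfl⟩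
      refine ⟨(s, k), ⟨hk, ?_⟩, rfl⟩
      simp only
      split_ifs at hs <;> omega
  rw [hU, projMatrix_biUnion]
  · rw [scanProj, ← Finset.sum_filter_add_sum_filter_not (Finset.Icc 1 K) (fun k => k < j)]
    congr 1
    · refine Finset.sum_congr rfl fun k hk => ?_
      rw [if_pos (Finset.mem_filter.1 hk).2, blockProj]
    · refine Finset.sum_congr (by simp only [not_lt]) fun k hk => ?_
      rw [if_neg (Finset.mem_filter.1 hk).2, blockProj]
  · rintro k _ l _ hkl v ⟨s, _, rfl⟩ w ⟨s', _, rfl⟩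
    exact spinBlock_dotProduct_eq_zero hkl

end Scan

/-! ### Measurability of the scan. -/

section ScanMeasurable

variable {N : ℕ} {α : Type*} [MeasurableSpace α] {c : unitInterval → ℝ → ℤˣ}
  {A : α → Matrix (Fin N) (Fin N) ℝ}

instance : MeasurableSingletonClass ℤˣ where
  measurableSet_singleton u :=
    ⟨{(u : ℤ)}, MeasurableSet.of_discrete, by ext v; simp [Units.ext_iff]⟩

instance : MeasurableSingletonClass (SpinConfig N) :=
  inferInstanceAs (MeasurableSingletonClass (Fin N → ℤˣ))

theorem measurable_spinConfig_toReal : Measurable (SpinConfig.toReal : SpinConfig N → _) :=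
  measurable_of_finite _

theorem measurable_blockUpdate (hc : Measurable (Function.uncurry c)) (n j : ℕ)
    {u : α → Fin N → unitInterval} {s : α → SpinConfig N} (hA : Measurable A)
    (hu : Measurable u) (hs : Measurable s) :
    Measurable fun x => blockUpdate n c (A x) (u x) j (s x) := by
  refine measurable_pi_lambda _ fun i => ?_
  unfold blockUpdate
  by_cases hi : i ∈ block N n j
  · simp only [if_pos hi]
    exact hc.comp (((measurable_pi_apply i).comp hu).prodMk ((measurable_pi_apply i).comp
      (hA.matrix_mulVec (measurable_spinConfig_toReal.comp hs))))
  · simp only [if_neg hi]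
    exact (measurable_pi_apply i).comp hs

theorem measurable_passState (hc : Measurable (Function.uncurry c)) (n : ℕ)
    {u : α → Fin N → unitInterval} {s : α → SpinConfig N} (hA : Measurable A)
    (hu : Measurable u) (hs : Measurable s) (m : ℕ) :
    Measurable fun x => passState n c (A x) (u x) (s x) m := by
  induction m with
  | zero => exact hs
  | succ m ih => exact measurable_blockUpdate hc n (m + 1) hA hu ih

theorem measurable_scanState (hc : Measurable (Function.uncurry c)) (K n : ℕ)
    {u : α → ℕ → Fin N → unitInterval} {s : α → SpinConfig N} (hA : Measurable A)
    (hu : Measurable u) (hs : Measurable s) (t : ℕ) :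
    Measurable fun x => scanState K n c (A x) (u x) (s x) t := by
  induction t with
  | zero => exact hs
  | succ t ih => exact measurable_passState hc n hA ((measurable_pi_apply (t + 1)).comp hu) ih K

theorem measurable_spinBlock (hc : Measurable (Function.uncurry c)) (K n : ℕ)
    {u : α → ℕ → Fin N → unitInterval} {s : α → SpinConfig N} (hA : Measurable A)
    (hu : Measurable u) (hs : Measurable s) (t k : ℕ) :
    Measurable fun x => spinBlock K n c (A x) (u x) (s x) t k := by
  classical
  exact (measurable_of_finite fun (s : SpinConfig N) (i : Fin N) =>
    if i ∈ block N n k then s.toReal i else 0).comp (measurable_scanState hc K n hA hu hs t)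

/-- The projector factors through the configurations after passes `0, …, t`, a finite discrete space
on which every map is measurable. -/
theorem measurable_projMatrix_revealedBlocks (hc : Measurable (Function.uncurry c)) (K n : ℕ)
    {u : α → ℕ → Fin N → unitInterval} {s : α → SpinConfig N} (hA : Measurable A)
    (hu : Measurable u) (hs : Measurable s) (t j : ℕ) :
    Measurable fun x => projMatrix (revealedBlocks K n c (A x) (u x) (s x) t j) := by
  classical
  let F : (Fin (t + 1) → SpinConfig N) → Matrix (Fin N) (Fin N) ℝ := fun S =>
    projMatrix {v | ∃ r : Fin (t + 1), ∃ k, ((r : ℕ), k) ∈ earlierTimes K t j ∧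
      v = fun i => if i ∈ block N n k then (S r).toReal i else 0}
  have hF : Measurable F := measurable_of_finite _
  have hS : Measurable fun x => fun r : Fin (t + 1) => scanState K n c (A x) (u x) (s x) r :=
    measurable_pi_lambda _ fun r => measurable_scanState hc K n hA hu hs r
  convert hF.comp hS using 1
  funext x
  simp only [F, Function.comp_apply, revealedBlocks]
  congr 1
  ext v
  simp only [Set.mem_image, Set.mem_ofPred_eq]
  constructor
  · rintro ⟨p, hp, rfl⟩
    have hlt : p.1 < t + 1 := by have := hp.2; omega
    exact ⟨⟨p.1, hlt⟩, p.2, hp, by funext i; simp only [spinBlock]⟩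
  · rintro ⟨r, k, hp, rfl⟩
    exact ⟨(r, k), hp, by funext i; simp only [spinBlock]⟩

end ScanMeasurable

/-! ### From equality of joint laws to equality of conditional laws. -/

section ConditionalLaw

variable {N : ℕ}

theorem CondIdentDistrib.of_measure_inter_eq {Ω E : Type*} {m mΩ : MeasurableSpace Ω}
    [MeasurableSpace E] {μ : Measure Ω} [IsProbabilityMeasure μ]
    (hm : m ≤ mΩ) {X Y : Ω → E} (hX : Measurable X) (hY : Measurable Y)
    (h : ∀ B, MeasurableSet B → ∀ S, MeasurableSet[m] S → μ (X ⁻¹' B ∩ S) = μ (Y ⁻¹' B ∩ S)) :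
    CondIdentDistrib μ m X Y := by
  refine ⟨hm, hX.aemeasurable, hY.aemeasurable, fun B hB => ?_⟩
  have hi (Z : Ω → E) (hZ : Measurable Z) :
      Integrable ((Z ⁻¹' B).indicator fun _ => (1 : ℝ)) μ :=
    (integrable_const 1).indicator (hZ hB)
  refine ae_eq_condExp_of_forall_setIntegral_eq hm (hi Y hY)
    (fun _ _ _ => integrable_condExp.integrableOn) (fun S hS _ => ?_)
    stronglyMeasurable_condExp.aestronglyMeasurable
  rw [setIntegral_condExp hm (hi X hX) hS, setIntegral_indicator (hX hB),
    setIntegral_indicator (hY hB)]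
  simp only [setIntegral_const, smul_eq_mul, mul_one, measureReal_def]
  rw [Set.inter_comm, h B hB S hS, Set.inter_comm]

/-- If `(W, J)` and `(W, J')` have the same law and `m` is coarser than the `σ`-algebra of a
statistic with the same values at `(W, J)` and `(W, J')`, then a function of `(W, J)` and the same
function of `(W, J')` have the same conditional law given `m`. -/
theorem CondIdentDistrib.of_map_eq {Ω E E₁ E₂ : Type*} {m mΩ : MeasurableSpace Ω}
    [MeasurableSpace E] [MeasurableSpace E₁] [MeasurableSpace E₂]
    {μ : Measure Ω} [IsProbabilityMeasure μ]
    {V V' : Ω → E₁} (hV : Measurable V) (hV' : Measurable V') (hmap : μ.map V = μ.map V')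
    {G : E₁ → E₂} (hG : Measurable G) (hGV : ∀ ω, G (V ω) = G (V' ω))
    (hm : m ≤ MeasurableSpace.comap (fun ω => G (V ω)) inferInstance)
    {F : E₁ → E} (hF : Measurable F) :
    CondIdentDistrib μ m (fun ω => F (V ω)) (fun ω => F (V' ω)) := by
  refine .of_measure_inter_eq (hm.trans (hG.comp hV).comap_le) (hF.comp hV) (hF.comp hV') ?_
  intro B hB S hS
  -- The conditioning event is read off from `G`, so it is the same event for `V` and `V'`, and
  -- equality of their laws applies to the intersection.
  obtain ⟨C, hC, rfl⟩ := hm _ hS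
  have hD : MeasurableSet (F ⁻¹' B ∩ G ⁻¹' C) := (hF hB).inter (hG hC)
  have h1 := Measure.map_apply hV hD (μ := μ)
  have h2 := Measure.map_apply hV' hD (μ := μ)
  have e : V' ⁻¹' (F ⁻¹' B ∩ G ⁻¹' C) =
      (fun ω => F (V' ω)) ⁻¹' B ∩ (fun ω => G (V ω)) ⁻¹' C := by
    ext ω
    simp only [Set.mem_inter_iff, Set.mem_preimage, hGV]
  rw [hmap, h2, e] at h1
  exact h1.symm

/-- Resampling along a projector adapted to independent data `W` preserves the joint law. -/
theorem map_prodMk_resample_eq {Ω E : Type*} {mΩ : MeasurableSpace Ω} [MeasurableSpace E]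
    {μ : Measure Ω} [IsProbabilityMeasure μ] {W : Ω → E} {J Jt : Ω → Matrix (Fin N) (Fin N) ℝ}
    (hW : Measurable W) (hJ : Measurable J) (hJt : Measurable Jt)
    (hlaw : μ.map Jt = μ.map J) (hJW : IndepFun J W μ)
    (hJtJW : IndepFun Jt (fun ω => (J ω, W ω)) μ)
    {P : E → Matrix (Fin N) (Fin N) ℝ → Matrix (Fin N) (Fin N) ℝ}
    (hP : Measurable (Function.uncurry P)) (hinv : ∀ w, ResampleInvariant (μ.map J) (P w)) :
    μ.map (fun ω => (W ω, J ω)) =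
      μ.map (fun ω => (W ω, resample (P (W ω) (J ω)) (J ω) (Jt ω))) := by
  have hWJ : Measurable fun ω => (W ω, J ω) := hW.prodMk hJ
  have hR : Measurable fun p : (E × Matrix (Fin N) (Fin N) ℝ) × Matrix (Fin N) (Fin N) ℝ =>
      (p.1.1, resample (P p.1.1 p.1.2) p.1.2 p.2) :=
    (measurable_fst.comp measurable_fst).prodMk ((hP.comp measurable_fst).resample
      (measurable_snd.comp measurable_fst) measurable_snd)
  have := Measure.isProbabilityMeasure_map (μ := μ) hJ.aemeasurable
  have := Measure.isProbabilityMeasure_map (μ := μ) hW.aemeasurable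
  have h1 : μ.map (fun ω => (W ω, J ω)) = (μ.map W).prod (μ.map J) :=
    hJW.symm.map_prod_eq_prod_map_map hW.aemeasurable hJ.aemeasurable
  have h2 : μ.map (fun ω => ((W ω, J ω), Jt ω)) = ((μ.map W).prod (μ.map J)).prod (μ.map J) := by
    have hi : IndepFun (fun ω => (W ω, J ω)) Jt μ :=
      (hJtJW.comp measurable_id measurable_swap).symm
    rw [hi.map_prod_eq_prod_map_map hWJ.aemeasurable hJt.aemeasurable, h1, hlaw]
  have h3 : μ.map (fun ω => (W ω, resample (P (W ω) (J ω)) (J ω) (Jt ω))) =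
      (((μ.map W).prod (μ.map J)).prod (μ.map J)).map (fun p =>
        (p.1.1, resample (P p.1.1 p.1.2) p.1.2 p.2)) := by
    rw [← h2, Measure.map_map hR (hWJ.prodMk hJt)]
    rfl
  rw [h1, h3]
  refine Measure.ext_of_lintegral _ fun f hf => ?_
  have hfR := hf.comp hR
  rw [lintegral_map hf hR, lintegral_prod _ hf.aemeasurable]
  rw [lintegral_prod (fun p : (E × Matrix (Fin N) (Fin N) ℝ) × Matrix (Fin N) (Fin N) ℝ =>
    f (p.1.1, resample (P p.1.1 p.1.2) p.1.2 p.2)) hfR.aemeasurable]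
  rw [lintegral_prod (fun q : E × Matrix (Fin N) (Fin N) ℝ =>
    ∫⁻ A', f (q.1, resample (P q.1 q.2) q.2 A') ∂μ.map J) hfR.lintegral_prod_right'.aemeasurable]
  -- By independence the data `w` can be frozen, and `P w` then depends on the matrix alone.
  refine lintegral_congr fun w => ?_
  exact (hinv w (fun A => f (w, A)) (hf.comp (measurable_const.prodMk measurable_id))).symm

end ConditionalLaw

/-! ### Resampling for the block scan, and the theorem. -/

section ScanConditionalLaw

variable {N K n : ℕ} {c : unitInterval → ℝ → ℤˣ}

theorem ResampleInvariant.revealedBlocks_succ (hN : N = K * n)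
    (hc : Measurable (Function.uncurry c)) {γ : Measure (Matrix (Fin N) (Fin N) ℝ)}
    [IsProbabilityMeasure γ] (hγ : HasGOECharFun γ) {u : ℕ → Fin N → unitInterval}
    {s₀ : SpinConfig N} {t j : ℕ}
    (h : ResampleInvariant γ fun A => projMatrix (revealedBlocks K n c A u s₀ t j)) :
    ResampleInvariant γ fun A => projMatrix (revealedBlocks K n c A u s₀ t (j + 1)) := by
  have hsub (A : Matrix (Fin N) (Fin N) ℝ) :
      revealedBlocks K n c A u s₀ t j ⊆ revealedBlocks K n c A u s₀ t (j + 1) :=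
    Set.image_mono (earlierTimes_subset_succ K t j)
  exact h.step hγ
    (measurable_projMatrix_revealedBlocks hc K n measurable_id measurable_const measurable_const
      t (j + 1))
    (fun _ => projMatrix_mul_self _) (fun _ => projMatrix_mul_self _)
    (fun _ => projMatrix_transpose _) (fun A => projMatrix_mul_of_subset' (hsub A))
    (fun A => projMatrix_mul_of_subset (hsub A))
    (fun _ _ hX => congrArg projMatrix (revealedBlocks_eq_of_mul_projMatrix_eq hN hX).2)

theorem resampleInvariant_revealedBlocks (hN : N = K * n) (hc : Measurable (Function.uncurry c))
    {γ : Measure (Matrix (Fin N) (Fin N) ℝ)} [IsProbabilityMeasure γ] (hγ : HasGOECharFun γ)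
    (u : ℕ → Fin N → unitInterval) (s₀ : SpinConfig N) (t j : ℕ) (hj : 1 ≤ j) :
    ResampleInvariant γ fun A => projMatrix (revealedBlocks K n c A u s₀ t j) := by
  induction t generalizing j with
  | zero =>
    induction j, hj using Nat.le_induction with
    | base =>
      simp only [revealedBlocks, earlierTimes_zero_one, Set.image_empty, projMatrix_empty]
      exact resampleInvariant_zero γ
    | succ j _ ih => exact ih.revealedBlocks_succ hN hc hγ
  | succ t iht =>
    induction j, hj using Nat.le_induction with
    | base =>
      simp only [revealedBlocks, earlierTimes_succ_one]
      exact iht (K + 1) (by omega)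
    | succ j _ ih => exact ih.revealedBlocks_succ hN hc hγ

/-- The initial configuration, the seeds, and the products of the matrix with the spin blocks
revealed before time `(t, j)`. -/
noncomputable def scanObservation (K n : ℕ) (c : unitInterval → ℝ → ℤˣ) (t j : ℕ)
    (V : (SpinConfig N × (ℕ → Fin N → unitInterval)) × Matrix (Fin N) (Fin N) ℝ) :
    (SpinConfig N × (ℕ → Fin N → unitInterval)) × (earlierTimes K t j → Fin N → ℝ) :=
  (V.1, fun p => V.2.mulVec (spinBlock K n c V.2 V.1.2 V.1.1 p.1.1 p.1.2))

theorem measurable_scanObservation (hc : Measurable (Function.uncurry c)) (t j : ℕ) :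
    Measurable (scanObservation (N := N) K n c t j) := by
  refine measurable_fst.prodMk (measurable_pi_lambda _ fun p => ?_)
  exact measurable_snd.matrix_mulVec (measurable_spinBlock hc K n measurable_snd
    (measurable_snd.comp measurable_fst) (measurable_fst.comp measurable_fst) _ _)

/-- The observation contains all the seeds, which covers every admissible enlargement of the
filtration at once. -/
theorem scanFiltration_sup_comap_le {Ω : Type*} (J : Ω → Matrix (Fin N) (Fin N) ℝ)
    (U : Ω → ℕ → Fin N → unitInterval) (σ₀ : Ω → SpinConfig N) (t j : ℕ) :
    scanFiltration K n c J U σ₀ t j ⊔ MeasurableSpace.comap U inferInstance ≤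
      MeasurableSpace.comap (fun ω => scanObservation K n c t j ((σ₀ ω, U ω), J ω))
        inferInstance := by
  have h := @comap_measurable _ _ inferInstance (fun ω => scanObservation K n c t j ((σ₀ ω, U ω), J ω))
  refine sup_le (sup_le ?_ (iSup₂_le fun p hp => ?_)) ?_
  · exact (measurable_fst.comp (measurable_fst.comp h)).comap_le
  · exact ((measurable_pi_apply (⟨p, hp⟩ : earlierTimes K t j)).comp
      (measurable_snd.comp h)).comap_le
  · exact (measurable_snd.comp (measurable_fst.comp h)).comap_le

/-- The resampled matrix acts identically on the revealed span, so its own scan produces the same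
revealed blocks and the same products. -/
theorem scanObservation_resample (hN : N = K * n) (t j : ℕ)
    (w : SpinConfig N × (ℕ → Fin N → unitInterval)) (A A' : Matrix (Fin N) (Fin N) ℝ) :
    scanObservation K n c t j (w, A) = scanObservation K n c t j
      (w, resample (projMatrix (revealedBlocks K n c A w.2 w.1 t j)) A A') := by
  have h := resample_mul_self (projMatrix_mul_self (revealedBlocks K n c A w.2 w.1 t j)) A A'
  refine Prod.ext rfl (funext fun p => ?_)
  simp only [scanObservation]
  rw [spinBlock_eq_of_mul_projMatrix_eq hN h (Or.inl p.2) p.2.1,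
    mulVec_eq_of_mul_projMatrix_eq h (Set.mem_image_of_mem _ p.2)]

end ScanConditionalLaw

theorem mainTheorem6
    {Ω : Type*} [mΩ : MeasurableSpace Ω] (μ : Measure Ω) [IsProbabilityMeasure μ]
    -- `K = 1/δ` blocks of size `n = δN`
    (N K n : ℕ) (hN : N = K * n)
    -- the update rule
    (c : unitInterval → ℝ → ℤˣ) (hc : Measurable (Function.uncurry c))
    -- the disorder, the initial configuration, the seeds, and the fresh GOE matrix
    (J : Ω → Matrix (Fin N) (Fin N) ℝ) (σ₀ : Ω → SpinConfig N)
    (U : Ω → ℕ → Fin N → unitInterval) (Jt : Ω → Matrix (Fin N) (Fin N) ℝ)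
    (hJ_meas : Measurable J) (hσ₀_meas : Measurable σ₀) (hU_meas : Measurable U)
    (hJt_meas : Measurable Jt)
    (hJ : IsGOE J μ) (hJt : IsGOE Jt μ)
    (hσ₀ : μ.map σ₀ = uniformOn Set.univ)
    (hU_law : ∀ t i, μ.map (fun ω => U ω t i) = volume)
    (hU_indep : iIndepFun (fun (p : ℕ × Fin N) ω => U ω p.1 p.2) μ)
    -- `σ₀`, `U`, `J`, `Jt` are independent
    (hσ₀U : IndepFun σ₀ U μ)
    (hJ_indep : IndepFun J (fun ω => (σ₀ ω, U ω)) μ)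
    (hJt_indep : IndepFun Jt (fun ω => (J ω, σ₀ ω, U ω)) μ)
    (t j : ℕ) (hj : j ∈ Finset.Icc 1 K)
    (P : Ω → Matrix (Fin N) (Fin N) ℝ)
    (hP : ∀ ω, P ω = scanProj K n c (J ω) (U ω) (σ₀ ω) t j) :
    -- `P` is the projector onto the span of the spin blocks revealed before time `(t, j)`
    (∀ ω, P ω = projMatrix
      ((fun p => spinBlock K n c (J ω) (U ω) (σ₀ ω) p.1 p.2) '' earlierTimes K t j)) ∧
    -- the conditional laws given `F_j^t`, possibly enlarged by seeds
    (∀ H : MeasurableSpace Ω,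
      scanFiltration K n c J U σ₀ t j ≤ H →
      H ≤ scanFiltration K n c J U σ₀ t j ⊔ MeasurableSpace.comap U inferInstance →
      CondIdentDistrib μ H
        (fun ω => (1 - P ω) * J ω * (1 - P ω))
        (fun ω => (1 - P ω) * Jt ω * (1 - P ω)) ∧
      CondIdentDistrib μ H
        J
        (fun ω => (1 - P ω) * Jt ω * (1 - P ω) + J ω * P ω + P ω * J ω * (1 - P ω))) := by
  have hPr (ω : Ω) : P ω = projMatrix (revealedBlocks K n c (J ω) (U ω) (σ₀ ω) t j) :=
    (hP ω).trans (scanProj_eq_projMatrix _ _ _ _ _)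
  refine ⟨hPr, ?_⟩
  have hW : Measurable fun ω => (σ₀ ω, U ω) := hσ₀_meas.prodMk hU_meas
  have hPm : Measurable (Function.uncurry
      fun (w : SpinConfig N × (ℕ → Fin N → unitInterval)) (A : Matrix (Fin N) (Fin N) ℝ) =>
        projMatrix (revealedBlocks K n c A w.2 w.1 t j)) :=
    measurable_projMatrix_revealedBlocks hc K n measurable_snd
      (measurable_snd.comp measurable_fst) (measurable_fst.comp measurable_fst) t j
  have := Measure.isProbabilityMeasure_map (μ := μ) hJ_meas.aemeasurable
  have := Measure.isProbabilityMeasure_map (μ := μ) hJt_meas.aemeasurable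
  have hγ := hJ.hasGOECharFun hJ_meas
  have hmap := map_prodMk_resample_eq hW hJ_meas hJt_meas
    ((hJt.hasGOECharFun hJt_meas).eq hγ) hJ_indep hJt_indep hPm
    fun w => resampleInvariant_revealedBlocks hN hc hγ w.2 w.1 t j (Finset.mem_Icc.1 hj).1
  have hV : Measurable fun ω => ((σ₀ ω, U ω), J ω) := hW.prodMk hJ_meas
  have hV' : Measurable fun ω => ((σ₀ ω, U ω), resample
      (projMatrix (revealedBlocks K n c (J ω) (U ω) (σ₀ ω) t j)) (J ω) (Jt ω)) :=
    hW.prodMk ((hPm.comp hV).resample hJ_meas hJt_meas)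
  have hQ := hPm.one_sub_matrix
  have key (H : MeasurableSpace Ω) (hH : H ≤ scanFiltration K n c J U σ₀ t j ⊔
      MeasurableSpace.comap U inferInstance)
      {F : (SpinConfig N × (ℕ → Fin N → unitInterval)) × Matrix (Fin N) (Fin N) ℝ →
      Matrix (Fin N) (Fin N) ℝ} (hF : Measurable F) :=
    CondIdentDistrib.of_map_eq hV hV' hmap (measurable_scanObservation hc t j)
      (fun ω => scanObservation_resample hN t j (σ₀ ω, U ω) (J ω) (Jt ω))
      (hH.trans (scanFiltration_sup_comap_le J U σ₀ t j)) hF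
  intro H _ hH
  constructor
  · convert key H hH ((hQ.matrix_mul measurable_snd).matrix_mul hQ) using 2 with ω ω
    · simp only [hPr, Function.uncurry]
    · have h := resample_mul_self (projMatrix_mul_self
        (revealedBlocks K n c (J ω) (U ω) (σ₀ ω) t j)) (J ω) (Jt ω)
      simp only [Function.uncurry]
      -- The projector recomputed from the resampled matrix is again `P`, so its compression is that
      -- of `Jt`.
      rw [(revealedBlocks_eq_of_mul_projMatrix_eq hN h).1,
        compress_resample (projMatrix_mul_self _), hPr]
  · convert key H hH measurable_snd using 2 with ω
    simp only [hPr, resample]
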